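/- Call $\alpha:\mathbb{R}_{\ge 0}\to\mathbb{R}_{\ge 0}$ class-$\mathcal K$ if it is continuous, strictly increasing and $\alpha(0)=0$. Call $\beta:\mathbb{R}_{\ge 0}\times\mathbb{R}_{\ge 0}\to\mathbb{R}_{\ge 0}$ class-$\mathcal{KL}$ if for each $t\ge 0$ the function $\beta(\cdot,t)$ is nondecreasing with $\lim_{s\to 0^+}\beta(s,t)=0$, and for each $s\ge 0$ the function $\beta(s,\cdot)$ is nonincreasing with $\lim_{t\to\infty}\beta(s,t)=0$. Let $\gamma_{ij}:\mathbb{R}\to\mathbb{R}$ ($i,j\in\{1,\dots,p\}$, $i\ne j$) be locally Lipschitz functions such that for all $i\neq j$: (i) $\gamma_{ij}(0)=0$ and $s\gamma_{ij}(s)\ge 0$ for all $s\in\mathbb{R}$; (ii) either $\gamma_{ij}\equiv 0$, or there is a class-$\mathcal K$ function $\alpha$ with $|\gamma_{ij}(s)|\ge\alpha(|s|)$ for all $s\in\mathbb{R}$. Suppose that this interconnection is connected: the directed graph on $\{1,\dots,p\}$ with an edge from $i$ to $j$ ($i\ne j$) exactly when $\gamma_{ij}\not\equiv 0$ has a node to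 which there is a directed path from every other node. For $x\in\mathbb{R}^2$ put $$\bar\gamma_{ij}(x)=\frac{1}{2\pi}\int_0^{2\pi}\begin{bmatrix}-\sin\varphi\\ \cos\varphi\end{bmatrix}\gamma_{ij}\big([-\sin\varphi\ \ \cos\varphi]\,x\big)\,d\varphi,$$ and consider the averaged system $$\dot\eta_i=\sum_{j\ne i}\bar\gamma_{ij}(\eta_j-\eta_i),\qquad i=1,\dots,p,$$ with state $\eta=(\eta_1,\dots,\eta_p)\in(\mathbb{R}^2)^p=\mathbb{R}^{2p}$. Let $\mathcal A=\{\eta\in\mathbb{R}^{2p}:\eta_i=\eta_j\text{ for all }i,j\}$ be the synchronization manifold, and let $|\eta|_{\mathcal A}$ denote the Euclidean distance from $\eta$ to $\mathcal A$. Then $\mathcal A$ is globally asymptotically stable: from every initial state there is a solution defined for all $t\ge 0$, and there exists a class-$\mathcal{KL}$ function $\beta$ such that every solution $\eta:[0,\infty)\to\mathbb{R}^{2p}$ satisfies $$|\eta(t)|_{\mathcal A}\le\beta\big(|\eta(0)|_{\mathcal A},t\big)\qquad\text{for all }t\ge 0.$$ -/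

import Mathlib

open scoped NNReal Topology

/-- Class-`K` functions: continuous, zero at zero, strictly increasing. -/
structure IsClassK (α : ℝ≥0 → ℝ≥0) : Prop where
  continuous : Continuous α
  map_zero : α 0 = 0
  strictMono : StrictMono α

/-- Class-`KL` functions. -/
structure IsClassKL (β : ℝ≥0 → ℝ≥0 → ℝ≥0) : Prop where
  monotone_left : ∀ t, Monotone fun s => β s t
  tendsto_left : ∀ t, Filter.Tendsto (fun s => β s t) (𝓝[>] 0) (𝓝 0)
  antitone_right : ∀ s, Antitone (β s)
  tendsto_right : ∀ s, Filter.Tendsto (β s) Filter.atTop (𝓝 0)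

/-- Stacked states `x = (x₁, …, x_p) ∈ ℝ^{np}` with `x_i ∈ ℝⁿ`; the coordinate `(i, k)` is the `k`-th
coordinate of `x_i`. -/
abbrev StackedState (p n : ℕ) : Type :=
  EuclideanSpace ℝ (Fin p × Fin n)

/-- The `i`-th component state `x_i ∈ ℝⁿ` of a stacked state. -/
def StackedState.block {p n : ℕ} (x : StackedState p n) (i : Fin p) : EuclideanSpace ℝ (Fin n) :=
  WithLp.toLp 2 fun k => x (i, k)

/-- The synchronization manifold: all the component states agree. -/
def syncManifold (p n : ℕ) : Set (StackedState p n) :=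
  {x | ∀ i j, StackedState.block x i = StackedState.block x j}

/-- A family of coupling functions is an interconnection. Only the functions `γ i j` with `i ≠ j`
matter; the diagonal ones are ignored everywhere. -/
structure IsInterconnection {p : ℕ} (γ : Fin p → Fin p → ℝ → ℝ) : Prop where
  map_zero : ∀ i j, i ≠ j → γ i j 0 = 0
  mul_nonneg : ∀ i j, i ≠ j → ∀ s, 0 ≤ s * γ i j s
  zero_or_bound : ∀ i j, i ≠ j →
    (∀ s, γ i j s = 0) ∨ ∃ α, IsClassK α ∧ ∀ s : ℝ, (α ‖s‖₊ : ℝ) ≤ |γ i j s|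

/-- The graph of an interconnection: an edge from `i` to `j` iff `γ i j` is not identically
zero. -/
def interconnectionGraph {p : ℕ} (γ : Fin p → Fin p → ℝ → ℝ) : Digraph (Fin p) where
  Adj i j := i ≠ j ∧ ∃ s, γ i j s ≠ 0

/-- A directed graph is connected if it has a node to which there is a directed path from every
other node. -/
def Digraph.IsRootConnected {V : Type*} (G : Digraph V) : Prop :=
  ∃ r, ∀ v, v ≠ r → Relation.ReflTransGen G.Adj v r

/-- The unit vector `(-sin φ, cos φ)`. -/
noncomputable def rotVec (φ : ℝ) : EuclideanSpace ℝ (Fin 2) :=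
  !₂[-Real.sin φ, Real.cos φ]

/-- The time average of a scalar coupling function `g` along the rotation,
`x ↦ (1 / 2π) ∫₀^{2π} g ([-sin φ, cos φ] x) (-sin φ, cos φ) dφ`. -/
noncomputable def averagedCoupling (g : ℝ → ℝ) (x : EuclideanSpace ℝ (Fin 2)) :
    EuclideanSpace ℝ (Fin 2) :=
  (1 / (2 * Real.pi)) •
    ∫ φ in (0 : ℝ)..(2 * Real.pi), g (-Real.sin φ * x 0 + Real.cos φ * x 1) • rotVec φ

/-- The right-hand side of the averaged system: the `i`-th component is the sum over `j ≠ i` of the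
averaged coupling of `γ i j` at `η j - η i`. -/
noncomputable def averagedField {p : ℕ} (γ : Fin p → Fin p → ℝ → ℝ) (η : StackedState p 2) :
    StackedState p 2 :=
  WithLp.toLp 2 fun ik =>
    (∑ j ∈ Finset.univ.erase ik.1,
      averagedCoupling (γ ik.1 j) (StackedState.block η j - StackedState.block η ik.1)) ik.2

/-- `η` solves the averaged system on `[0, ∞)` (with the one-sided derivative at time `0`). -/
def IsAveragedSolution {p : ℕ} (γ : Fin p → Fin p → ℝ → ℝ) (η : ℝ → StackedState p 2) : Prop :=
  ∀ t : ℝ, 0 ≤ t → HasDerivWithinAt η (averagedField γ (η t)) (Set.Ici 0) t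

/-!
The averaged coupling of `g` commutes with rotations and reflections of the plane, so it is radial:
it maps `x` to `radialGain g ‖x‖ • x` (`averagedCoupling_eq_radialGain_smul`), and the sign
condition makes the gain nonnegative, positive away from `0` when `g` vanishes only at `0`. The
averaged system is thus a consensus dynamics in the plane with state-dependent nonnegative gains,
and its components along any fixed direction follow a scalar consensus dynamics.

A maximum principle (`le_of_deriv_nonpos_at_max`) shows that discs containing all the blocks are
forward invariant, so that the spread, the largest distance between two blocks, never increases.
As it is comparable to the distance to the synchronization manifold, this gives uniform stability.
It also makes the values of the couplings at large arguments irrelevant: truncating them yields a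
bounded, globally Lipschitz field (`IsTame`), which has global solutions depending continuously on
the initial state.

Off the manifold the spread decreases strictly in any positive time (`IsTame.spread_lt`): with
bounded gains, a block that is extreme in some direction at time `t` at a value that was already
extreme initially has kept this value since time `0`, hence so have all nodes that influence it, in
particular the root. Conservation of the spread would put the root at both extremes. By translation
invariance and compactness the decrease over one unit of time is bounded below as long as the spread
lies between two positive bounds (`IsTame.exists_spread_add_le`), so attraction is uniform. Uniform
stability and uniform attraction give the class-`KL` function (`exists_isClassKL`).
-/

/-! ### The averaged coupling is radial -/

lemma norm_rotVec (φ : ℝ) : ‖rotVec φ‖ = 1 := by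
  simp [rotVec, EuclideanSpace.norm_eq]

lemma continuous_rotVec : Continuous rotVec := by
  refine (PiLp.continuous_toLp 2 _).comp (continuous_pi fun i => ?_)
  fin_cases i
  · exact Real.continuous_sin.neg
  · exact Real.continuous_cos

/-- The scalar fed into the coupling is the component of `x` along the unit vector `rotVec φ`. -/
lemma neg_sin_mul_add_cos_mul_eq_inner (φ : ℝ) (x : EuclideanSpace ℝ (Fin 2)) :
    -Real.sin φ * x 0 + Real.cos φ * x 1 = inner ℝ (rotVec φ) x := by
  simp [rotVec, PiLp.inner_apply, Fin.sum_univ_two]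
  ring

lemma averagedCoupling_eq_inner (g : ℝ → ℝ) (x : EuclideanSpace ℝ (Fin 2)) :
    averagedCoupling g x = (1 / (2 * Real.pi)) •
      ∫ φ in (0 : ℝ)..(2 * Real.pi), g (inner ℝ (rotVec φ) x) • rotVec φ := by
  simp only [averagedCoupling, neg_sin_mul_add_cos_mul_eq_inner]

lemma abs_inner_rotVec_le (φ : ℝ) (x : EuclideanSpace ℝ (Fin 2)) :
    |inner ℝ (rotVec φ) x| ≤ ‖x‖ := by
  simpa [norm_rotVec] using abs_real_inner_le_norm (rotVec φ) x

lemma continuous_averagedCoupling_integrand {g : ℝ → ℝ} (hg : Continuous g)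
    (x : EuclideanSpace ℝ (Fin 2)) :
    Continuous fun φ => g (inner ℝ (rotVec φ) x) • rotVec φ := by
  have := continuous_rotVec
  fun_prop

/-- Passing to a time average over a full period cannot increase a bound on the integrand. -/
lemma norm_average_le {f : ℝ → EuclideanSpace ℝ (Fin 2)} {C : ℝ} (hf : ∀ φ, ‖f φ‖ ≤ C) :
    ‖(1 / (2 * Real.pi)) • ∫ φ in (0 : ℝ)..(2 * Real.pi), f φ‖ ≤ C := by
  have hpi := Real.two_pi_pos
  have h := intervalIntegral.norm_integral_le_of_norm_le_const (a := 0) (b := 2 * Real.pi)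
    (f := f) (C := C) fun φ _ => hf φ
  rw [sub_zero, abs_of_pos hpi] at h
  rw [norm_smul, Real.norm_eq_abs, abs_of_pos (by positivity), one_div, inv_mul_le_iff₀ hpi]
  linarith

lemma norm_averagedCoupling_le {g : ℝ → ℝ} {B : ℝ} (hB : ∀ s, |g s| ≤ B)
    (x : EuclideanSpace ℝ (Fin 2)) : ‖averagedCoupling g x‖ ≤ B := by
  rw [averagedCoupling_eq_inner]
  refine norm_average_le fun φ => ?_
  simpa [norm_smul, norm_rotVec] using hB _

lemma lipschitzWith_averagedCoupling {g : ℝ → ℝ} {K : ℝ≥0} (hg : LipschitzWith K g) :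
    LipschitzWith K (averagedCoupling g) := by
  refine LipschitzWith.of_dist_le_mul fun x y => ?_
  rw [averagedCoupling_eq_inner, averagedCoupling_eq_inner, dist_eq_norm, ← smul_sub,
    ← intervalIntegral.integral_sub
      ((continuous_averagedCoupling_integrand hg.continuous x).intervalIntegrable _ _)
      ((continuous_averagedCoupling_integrand hg.continuous y).intervalIntegrable _ _)]
  refine norm_average_le fun φ => ?_
  rw [← sub_smul, norm_smul, norm_rotVec, mul_one, ← dist_eq_norm]
  refine (hg.dist_le_mul _ _).trans (mul_le_mul_of_nonneg_left ?_ K.2)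
  rw [Real.dist_eq, ← inner_sub_right, dist_eq_norm]
  exact abs_inner_rotVec_le φ _

/-- The averaged coupling at `x` only sees the values of `g` on `[-‖x‖, ‖x‖]`. -/
lemma averagedCoupling_congr {g h : ℝ → ℝ} {x : EuclideanSpace ℝ (Fin 2)}
    (hgh : ∀ s, |s| ≤ ‖x‖ → g s = h s) : averagedCoupling g x = averagedCoupling h x := by
  simp only [averagedCoupling_eq_inner, hgh _ (abs_inner_rotVec_le _ x)]

lemma exists_eq_norm_smul_rotVec (x : EuclideanSpace ℝ (Fin 2)) :
    ∃ θ, x = ‖x‖ • rotVec θ := by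
  have hn : ‖(⟨x 1, -x 0⟩ : ℂ)‖ = ‖x‖ := by
    rw [EuclideanSpace.norm_eq, Complex.norm_eq_sqrt_sq_add_sq]
    simp [Fin.sum_univ_two, add_comm]
  refine ⟨Complex.arg ⟨x 1, -x 0⟩, ?_⟩
  have h1 := Complex.norm_mul_cos_arg ⟨x 1, -x 0⟩
  have h2 := Complex.norm_mul_sin_arg ⟨x 1, -x 0⟩
  rw [hn] at h1 h2
  ext i
  fin_cases i
  · simp only [rotVec, PiLp.smul_apply, smul_eq_mul, Fin.zero_eta, Matrix.cons_val_zero]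
    simp at h2 ⊢
    linarith
  · simp [rotVec] at h1 ⊢
    linarith

lemma inner_rotVec_rotVec (φ θ : ℝ) : inner ℝ (rotVec φ) (rotVec θ) = Real.cos (φ - θ) := by
  simp [rotVec, PiLp.inner_apply, Fin.sum_univ_two, Real.cos_sub]
  ring

lemma rotVec_eq_cos_smul_add (φ θ : ℝ) :
    rotVec φ = Real.cos (φ - θ) • rotVec θ +
      Real.sin (φ - θ) • !₂[-Real.cos θ, -Real.sin θ] := by
  ext i
  have h := Real.sin_sq_add_cos_sq θ
  fin_cases i <;> simp [rotVec, Real.cos_sub, Real.sin_sub]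
  · linear_combination Real.sin φ * h
  · linear_combination (-Real.cos φ) * h

/-- The factor by which the averaged coupling stretches a vector of norm `r`. At `r = 0` the
division by zero makes it `0`, which is harmless since it then multiplies the zero vector. -/
noncomputable def radialGain (g : ℝ → ℝ) (r : ℝ) : ℝ :=
  (1 / (2 * Real.pi * r ^ 2)) *
    ∫ u in (-Real.pi)..Real.pi, r * Real.cos u * g (r * Real.cos u)

/-- The averaged coupling commutes with rotations and reflections of the plane, so it points along
its argument: the component across `x` is the integral of an odd function over a period. -/
lemma averagedCoupling_eq_radialGain_smul {g : ℝ → ℝ} (hg : Continuous g) (hg0 : g 0 = 0)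
    (x : EuclideanSpace ℝ (Fin 2)) : averagedCoupling g x = radialGain g ‖x‖ • x := by
  obtain hx | hx := eq_or_ne x 0
  · simp [hx, averagedCoupling_eq_inner, hg0]
  obtain ⟨θ, hθ⟩ := exists_eq_norm_smul_rotVec x
  have hr : ‖x‖ ≠ 0 := norm_ne_zero_iff.2 hx
  set r := ‖x‖
  set w : EuclideanSpace ℝ (Fin 2) := !₂[-Real.cos θ, -Real.sin θ]
  set f : ℝ → EuclideanSpace ℝ (Fin 2) := fun u =>
    (g (r * Real.cos u) * Real.cos u) • rotVec θ + (g (r * Real.cos u) * Real.sin u) • w with hf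
  have hper : Function.Periodic f (2 * Real.pi) := fun u => by simp [hf]
  have hodd : ∫ u in (-Real.pi)..Real.pi, g (r * Real.cos u) * Real.sin u = 0 := by
    have h := intervalIntegral.integral_comp_neg (a := -Real.pi) (b := Real.pi)
      fun u => g (r * Real.cos u) * Real.sin u
    simp only [Real.cos_neg, Real.sin_neg, mul_neg, neg_neg,
      intervalIntegral.integral_neg] at h
    linarith
  have hint : ∫ φ in (0 : ℝ)..(2 * Real.pi), g (inner ℝ (rotVec φ) x) • rotVec φ =
      ∫ u in (-Real.pi)..Real.pi, f u := by
    have h1 : ∀ φ, g (inner ℝ (rotVec φ) x) • rotVec φ = f (φ - θ) := fun φ => by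
      have h2 : inner ℝ (rotVec φ) x = r * Real.cos (φ - θ) := by
        rw [hθ, inner_smul_right, inner_rotVec_rotVec]
      rw [h2, rotVec_eq_cos_smul_add φ θ, smul_add, smul_smul, smul_smul]
    simp only [h1]
    rw [intervalIntegral.integral_comp_sub_right]
    have h3 := hper.intervalIntegral_add_eq (0 - θ) (-Real.pi)
    rw [show 0 - θ + 2 * Real.pi = 2 * Real.pi - θ by ring,
      show -Real.pi + 2 * Real.pi = Real.pi by ring] at h3
    exact h3
  have hsplit : ∫ u in (-Real.pi)..Real.pi, f u =
      (∫ u in (-Real.pi)..Real.pi, g (r * Real.cos u) * Real.cos u) • rotVec θ := by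
    rw [hf, intervalIntegral.integral_add, intervalIntegral.integral_smul_const,
      intervalIntegral.integral_smul_const, hodd, zero_smul, add_zero]
    all_goals exact Continuous.intervalIntegrable (by fun_prop) _ _
  have hgain : radialGain g r = (1 / (2 * Real.pi * r)) *
      ∫ u in (-Real.pi)..Real.pi, g (r * Real.cos u) * Real.cos u := by
    have : ∀ u, r * Real.cos u * g (r * Real.cos u) =
        r * (g (r * Real.cos u) * Real.cos u) := fun u => by ring
    simp only [radialGain, this, intervalIntegral.integral_const_mul]
    field_simp
  rw [averagedCoupling_eq_inner, hint, hsplit, hgain]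
  conv_rhs => rw [hθ]
  rw [smul_smul, smul_smul]
  congr 1
  field_simp

lemma radialGain_nonneg {g : ℝ → ℝ} (hg : ∀ s, 0 ≤ s * g s) (r : ℝ) : 0 ≤ radialGain g r := by
  have := Real.pi_pos
  exact mul_nonneg (by positivity)
    (intervalIntegral.integral_nonneg (by linarith) fun u _ => hg _)

lemma radialGain_pos {g : ℝ → ℝ} (hgc : Continuous g) (hg : ∀ s, 0 ≤ s * g s)
    (hg' : ∀ s, s ≠ 0 → g s ≠ 0) {r : ℝ} (hr : r ≠ 0) : 0 < radialGain g r := by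
  have := Real.pi_pos
  refine mul_pos (by positivity)
    (intervalIntegral.integral_pos (by linarith) (by fun_prop) (fun u _ => hg _)
      ⟨0, ⟨by linarith, by linarith⟩, ?_⟩)
  exact lt_of_le_of_ne (hg _) (mul_ne_zero (by simpa) (hg' _ (by simpa))).symm

lemma radialGain_le {g : ℝ → ℝ} {K : ℝ≥0} (hg : LipschitzWith K g) (hg0 : g 0 = 0)
    (hnn : ∀ s, 0 ≤ s * g s) (x : EuclideanSpace ℝ (Fin 2)) : radialGain g ‖x‖ ≤ K := by
  obtain rfl | hx := eq_or_ne x 0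
  · simp [radialGain]
  have h := (lipschitzWith_averagedCoupling hg).dist_le_mul x 0
  rw [averagedCoupling_eq_radialGain_smul hg.continuous hg0,
    averagedCoupling_eq_radialGain_smul hg.continuous hg0, smul_zero, dist_zero_right,
    dist_zero_right, norm_smul, Real.norm_eq_abs, abs_of_nonneg (radialGain_nonneg hnn _)] at h
  exact le_of_mul_le_mul_right h (norm_pos_iff.2 hx)

/-! ### Scalar consensus dynamics -/

/-- A maximum principle: if, at any time, the components attaining the maximum do not increase, then
an upper bound on all the components persists. -/
lemma le_of_deriv_nonpos_at_max {ι : Type*} [Finite ι] {y y' : ι → ℝ → ℝ}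
    (hy : ∀ i t, 0 ≤ t → HasDerivWithinAt (y i) (y' i t) (Set.Ici 0) t)
    (hmax : ∀ i t, 0 ≤ t → (∀ j, y j t ≤ y i t) → y' i t ≤ 0)
    {M : ℝ} (h0 : ∀ i, y i 0 ≤ M) (i : ι) {T : ℝ} (hT : 0 ≤ T) : y i T ≤ M := by
  -- The barrier `M + ε t` increases strictly, so no component can cross it.
  have key : ∀ ε : ℝ, 0 < ε → ∀ i, y i T ≤ M + ε * T := by
    intro ε hε
    set s : Set ℝ := {t | ∀ i, y i t ≤ M + ε * t}
    have hcont : ∀ i, ContinuousOn (y i) (Set.Ici 0) := fun i t ht =>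
      (hy i t ht).continuousWithinAt
    suffices h : Set.Icc 0 T ⊆ s from h ⟨hT, le_rfl⟩
    refine IsClosed.Icc_subset_of_forall_mem_nhdsWithin ?_ (by simpa [s] using h0) ?_
    · have : s ∩ Set.Icc 0 T = ⋂ i, {t ∈ Set.Icc 0 T | y i t ≤ M + ε * t} ∩ Set.Icc 0 T := by
        ext t
        simp only [s, Set.mem_inter_iff, Set.mem_iInter, Set.mem_ofPred_eq]
        constructor
        · exact fun h i => ⟨⟨h.2, h.1 i⟩, h.2⟩
        · intro h
          exact ⟨fun i => (h i).1.2, (h ‹ι›).2⟩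
      rw [this]
      exact isClosed_iInter fun i => (isClosed_Icc.isClosed_le
        ((hcont i).mono fun t ht => ht.1) (by fun_prop)).inter isClosed_Icc
    · rintro x ⟨hxs, hx0, hxT⟩
      refine Filter.eventually_all.2 fun i => ?_
      obtain hlt | heq := (hxs i).lt_or_eq
      · have h1 : ContinuousWithinAt (y i) (Set.Ioi x) x :=
          (hcont i x hx0).mono fun t ht => hx0.trans (le_of_lt ht)
        have h2 : ContinuousWithinAt (fun t => M + ε * t) (Set.Ioi x) x :=
          Continuous.continuousWithinAt (by fun_prop)
        exact (h1.eventually_lt h2 hlt).mono fun t ht => ht.le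
      · have hder : y' i x ≤ 0 := hmax i x hx0 fun j => (hxs j).trans heq.ge
        have h1 : HasDerivWithinAt (y i) (y' i x) (Set.Ioi x) x :=
          (hy i x hx0).mono fun t ht => hx0.trans (le_of_lt ht)
        filter_upwards [h1.limsup_slope_le' (lt_irrefl x) (hder.trans_lt hε),
          self_mem_nhdsWithin] with t ht hxt
        have hxt' : 0 < t - x := sub_pos.2 hxt
        rw [slope_def_field, div_lt_iff₀ hxt'] at ht
        linarith
  refine le_of_forall_pos_le_add fun δ hδ => (key (δ / (T + 1)) (by positivity) i).trans ?_
  have : δ / (T + 1) * T ≤ δ := by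
    rw [div_mul_eq_mul_div, div_le_iff₀ (by positivity)]
    nlinarith
  linarith

section Consensus

variable {ι : Type*} [Fintype ι] {y : ι → ℝ → ℝ} {a : ι → ι → ℝ → ℝ} {L M τ : ℝ}

lemma consensus_le
    (hy : ∀ i t, 0 ≤ t →
      HasDerivWithinAt (y i) (∑ j, a i j t * (y j t - y i t)) (Set.Ici 0) t)
    (ha : ∀ i j t, 0 ≤ a i j t) (h0 : ∀ i, y i 0 ≤ M) (i : ι) {t : ℝ} (ht : 0 ≤ t) :
    y i t ≤ M :=
  le_of_deriv_nonpos_at_max hy (fun i t _ h => Finset.sum_nonpos fun j _ =>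
    mul_nonpos_of_nonneg_of_nonpos (ha i j t) (sub_nonpos.2 (h j))) h0 i ht

/-- With bounded gains, a component approaches the upper bound `M` at most exponentially fast; so if
it equals `M` at some time, it did so ever since time `0`. -/
lemma consensus_eq_of_eq
    (hy : ∀ i t, 0 ≤ t →
      HasDerivWithinAt (y i) (∑ j, a i j t * (y j t - y i t)) (Set.Ici 0) t)
    (ha : ∀ i j t, 0 ≤ a i j t) (haL : ∀ i j t, a i j t ≤ L) (h0 : ∀ i, y i 0 ≤ M)
    {i : ι} (hi : y i τ = M) {t : ℝ} (ht : 0 ≤ t) (htτ : t ≤ τ) : y i t = M := by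
  have hle : ∀ i t, 0 ≤ t → y i t ≤ M := fun i t ht => consensus_le hy ha h0 i ht
  refine le_antisymm (hle i t ht) ?_
  set C : ℝ := Fintype.card ι * L
  have hd : ∀ t, 0 ≤ t → HasDerivWithinAt (fun t => (M - y i t) * Real.exp (C * t))
      ((-∑ j, a i j t * (y j t - y i t)) * Real.exp (C * t) +
        (M - y i t) * (Real.exp (C * t) * C)) (Set.Ici 0) t := fun t ht => by
    have h1 : HasDerivAt (fun t => Real.exp (C * t)) (Real.exp (C * t) * C) t := by
      simpa using ((hasDerivAt_id t).const_mul C).exp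
    exact ((hy i t ht).const_sub M).mul h1.hasDerivWithinAt
  have hmono : MonotoneOn (fun t => (M - y i t) * Real.exp (C * t)) (Set.Ici 0) := by
    refine monotoneOn_of_hasDerivWithinAt_nonneg (convex_Ici 0)
      (fun t ht => (hd t ht).continuousWithinAt)
      (fun t ht => (hd t (interior_subset ht)).mono interior_subset) fun t ht => ?_
    have ht0 : 0 ≤ t := interior_subset ht
    have hsum : ∑ j, a i j t * (y j t - y i t) ≤ C * (M - y i t) := by
      calc ∑ j, a i j t * (y j t - y i t) ≤ ∑ _j : ι, L * (M - y i t) := by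
            refine Finset.sum_le_sum fun j _ => ?_
            have h1 := hle j t ht0
            have h2 := hle i t ht0
            exact (mul_le_mul_of_nonneg_left (by linarith) (ha i j t)).trans
              (mul_le_mul_of_nonneg_right (haL i j t) (by linarith))
        _ = C * (M - y i t) := by simp [C, mul_assoc]
    have := mul_nonneg (sub_nonneg.2 hsum) (Real.exp_pos (C * t)).le
    linarith
  have h := hmono (Set.mem_Ici.2 ht) (Set.mem_Ici.2 (ht.trans htτ)) htτ
  simp only [hi, sub_self, zero_mul] at h
  have := nonpos_of_mul_nonpos_left h (Real.exp_pos (C * t))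
  linarith

/-- If some component equals the initial upper bound `M` at time `τ > 0`, then every component that
influences it, directly or through others, starts at `M`. -/
lemma consensus_initial_eq_of_eq
    (hy : ∀ i t, 0 ≤ t →
      HasDerivWithinAt (y i) (∑ j, a i j t * (y j t - y i t)) (Set.Ici 0) t)
    (ha : ∀ i j t, 0 ≤ a i j t) (haL : ∀ i j t, a i j t ≤ L) {E : ι → ι → Prop}
    (hE : ∀ i j t, E i j → a i j t = 0 → y j t = y i t) (h0 : ∀ i, y i 0 ≤ M) (hτ : 0 < τ)
    {i r : ι} (hi : y i τ = M) (hir : Relation.ReflTransGen E i r) : y r 0 = M := by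
  suffices h : ∀ t, 0 ≤ t → t < τ → y r t = M from h 0 le_rfl hτ
  induction hir with
  | refl => exact fun t ht htτ => consensus_eq_of_eq hy ha haL h0 hi ht htτ.le
  | @tail j k _ hjk ih =>
    intro t ht htτ
    -- The component `j` is constant on `[0, τ)`, so its right derivative vanishes there.
    have hzero : ∑ l, a j l t * (y l t - y j t) = 0 := by
      have h1 := (hy j t ht).mono (Set.Ici_subset_Ici.2 ht)
      have h2 : HasDerivWithinAt (y j) 0 (Set.Ici t) t := by
        refine (hasDerivWithinAt_const t (Set.Ici t) M).congr_of_eventuallyEq ?_ (ih t ht htτ)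
        filter_upwards [Ico_mem_nhdsGE htτ] with u hu using ih u (ht.trans hu.1) hu.2
      exact (uniqueDiffOn_Ici t t Set.self_mem_Ici).eq_deriv _ h1 h2
    have hterm : ∀ l ∈ Finset.univ, a j l t * (y l t - y j t) ≤ 0 := fun l _ => by
      refine mul_nonpos_of_nonneg_of_nonpos (ha j l t) ?_
      rw [ih t ht htτ]
      exact sub_nonpos.2 (consensus_le hy ha h0 l ht)
    have hk := (Finset.sum_eq_zero_iff_of_nonpos hterm).1 hzero k (Finset.mem_univ k)
    rw [← ih t ht htτ]
    obtain hk | hk := mul_eq_zero.1 hk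
    · exact hE j k t hjk hk
    · exact sub_eq_zero.1 hk

end Consensus

/-! ### Global solutions of bounded Lipschitz vector fields -/

section GlobalSolutions

variable {E : Type*} [NormedAddCommGroup E] [NormedSpace ℝ E] {F : E → E} {K : ℝ≥0}

lemma dist_le_of_hasDerivWithinAt_Ici (hF : LipschitzWith K F) {η ξ : ℝ → E}
    (hη : ∀ t, 0 ≤ t → HasDerivWithinAt η (F (η t)) (Set.Ici 0) t)
    (hξ : ∀ t, 0 ≤ t → HasDerivWithinAt ξ (F (ξ t)) (Set.Ici 0) t) {t : ℝ} (ht : 0 ≤ t) :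
    dist (η t) (ξ t) ≤ dist (η 0) (ξ 0) * Real.exp (K * t) := by
  have h := dist_le_of_trajectories_ODE (v := fun _ => F) (a := 0) (b := t) (fun _ => hF)
    (fun s hs => (hη s hs.1).continuousWithinAt.mono fun u hu => hu.1)
    (fun s hs => (hη s hs.1).mono (Set.Ici_subset_Ici.2 hs.1))
    (fun s hs => (hξ s hs.1).continuousWithinAt.mono fun u hu => hu.1)
    (fun s hs => (hξ s hs.1).mono (Set.Ici_subset_Ici.2 hs.1)) le_rfl t ⟨ht, le_rfl⟩
  simpa using h

/-- As the field is bounded, the Picard–Lindelöf theorem applies on every interval `[0, n + 1]`, and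
uniqueness glues the solutions so obtained. -/
lemma exists_hasDerivWithinAt_Ici [CompleteSpace E] (hF : LipschitzWith K F) {B : ℝ≥0}
    (hB : ∀ x, ‖F x‖ ≤ B) (x : E) :
    ∃ η : ℝ → E, (∀ t, 0 ≤ t → HasDerivWithinAt η (F (η t)) (Set.Ici 0) t) ∧ η 0 = x := by
  have hsol : ∀ n : ℕ, ∃ α : ℝ → E, α 0 = x ∧
      ∀ t ∈ Set.Icc (0 : ℝ) (n + 1), HasDerivWithinAt α (F (α t)) (Set.Icc 0 (n + 1)) t := by
    intro n
    have hpl : IsPicardLindelof (fun _ => F) (tmin := 0) (tmax := n + 1)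
        ⟨0, le_rfl, by positivity⟩ x (B * (n + 1)) 0 B K :=
      ⟨fun _ _ => hF.lipschitzOnWith, fun _ _ => continuousOn_const, fun _ _ y _ => hB y, by
        have : (0 : ℝ) ≤ n + 1 := by positivity
        simp [this]⟩
    exact hpl.exists_eq_forall_mem_Icc_hasDerivWithinAt₀
  choose α hα0 hα using hsol
  have hcompat : ∀ n m : ℕ, n ≤ m → ∀ t ∈ Set.Icc (0 : ℝ) (n + 1), α n t = α m t := by
    intro n m hnm
    have hnm' : (n : ℝ) ≤ m := by exact_mod_cast hnm
    have hright : ∀ k : ℕ, (n : ℝ) ≤ k → ∀ t ∈ Set.Ico (0 : ℝ) (n + 1),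
        HasDerivWithinAt (α k) (F (α k t)) (Set.Ici t) t := fun k hk t ht =>
      (hα k t ⟨ht.1, by linarith [ht.2]⟩).mono_of_mem_nhdsWithin <|
        Filter.mem_of_superset (Icc_mem_nhdsGE ht.2) fun u hu =>
          ⟨ht.1.trans hu.1, hu.2.trans (by linarith)⟩
    have hcont : ∀ k : ℕ, (n : ℝ) ≤ k → ContinuousOn (α k) (Set.Icc (0 : ℝ) (n + 1)) :=
      fun k hk t ht => (hα k t ⟨ht.1, by linarith [ht.2]⟩).continuousWithinAt.mono
        (Set.Icc_subset_Icc_right (by linarith))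
    exact ODE_solution_unique (v := fun _ => F) (fun _ => hF) (hcont n le_rfl)
      (hright n le_rfl) (hcont m hnm') (hright m hnm') (by rw [hα0, hα0])
  refine ⟨fun t => α ⌊t⌋₊ t, fun t ht => ?_, by simpa using hα0 0⟩
  have htn : t < ⌊t⌋₊ + 1 := Nat.lt_floor_add_one t
  refine HasDerivWithinAt.congr_of_eventuallyEq (f := α ⌊t⌋₊) ?_ ?_ rfl
  · refine (hα ⌊t⌋₊ t ⟨ht, htn.le⟩).mono_of_mem_nhdsWithin ?_
    exact Filter.mem_of_superset (inter_mem_nhdsWithin _ (Iic_mem_nhds htn)) fun u hu => hu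
  · filter_upwards [inter_mem_nhdsWithin (Set.Ici 0) (Iio_mem_nhds htn)] with u hu
    refine hcompat _ _ ?_ u ⟨hu.1, (Nat.lt_floor_add_one u).le⟩
    exact Nat.lt_succ_iff.1 ((Nat.floor_lt hu.1).2 (by exact_mod_cast hu.2))

end GlobalSolutions

/-! ### Stacked states and their spread -/

section Spread

variable {p n : ℕ}

@[simp]
lemma StackedState.block_sub (x y : StackedState p n) (i : Fin p) :
    (x - y).block i = x.block i - y.block i := rfl

@[simp]
lemma StackedState.block_add (x y : StackedState p n) (i : Fin p) :
    (x + y).block i = x.block i + y.block i := rfl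

/-- The projection of a stacked state to its `i`-th block, as a linear map. -/
noncomputable def StackedState.blockₗ (p n : ℕ) (i : Fin p) :
    StackedState p n →ₗ[ℝ] EuclideanSpace ℝ (Fin n) where
  toFun x := x.block i
  map_add' _ _ := rfl
  map_smul' _ _ := rfl

lemma StackedState.continuous_block (i : Fin p) :
    Continuous fun x : StackedState p n => x.block i :=
  (StackedState.blockₗ p n i).continuous_of_finiteDimensional

lemma StackedState.norm_sq_eq (x : StackedState p n) : ‖x‖ ^ 2 = ∑ i, ‖x.block i‖ ^ 2 := by
  simp only [EuclideanSpace.norm_sq_eq, StackedState.block, Fintype.sum_prod_type]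

lemma StackedState.norm_block_le (x : StackedState p n) (i : Fin p) : ‖x.block i‖ ≤ ‖x‖ := by
  refine le_of_sq_le_sq ?_ (norm_nonneg x)
  rw [x.norm_sq_eq]
  exact Finset.single_le_sum (f := fun i => ‖x.block i‖ ^ 2) (fun i _ => sq_nonneg _)
    (Finset.mem_univ i)

lemma StackedState.norm_le_of_norm_block_le {x : StackedState p n} {C : ℝ}
    (h : ∀ i, ‖x.block i‖ ≤ C) : ‖x‖ ≤ p * C := by
  have hsum : ‖x‖ ≤ ∑ i, ‖x.block i‖ := by
    refine le_of_sq_le_sq ?_ (Finset.sum_nonneg fun i _ => norm_nonneg _)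
    rw [x.norm_sq_eq]
    exact Finset.sum_sq_le_sq_sum_of_nonneg fun i _ => norm_nonneg _
  refine hsum.trans ((Finset.sum_le_sum fun i _ => h i).trans ?_)
  simp

/-- The stacked state all of whose blocks are `c`. -/
def StackedState.const (p : ℕ) {n : ℕ} (c : EuclideanSpace ℝ (Fin n)) : StackedState p n :=
  WithLp.toLp 2 fun ik => c ik.2

@[simp]
lemma StackedState.block_const (c : EuclideanSpace ℝ (Fin n)) (i : Fin p) :
    (StackedState.const p c).block i = c := rfl

/-- The largest distance between two blocks of a stacked state, that is, the diameter of the convex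
hull of the blocks. -/
noncomputable def spread (x : StackedState p n) : ℝ :=
  ‖fun ij : Fin p × Fin p => x.block ij.1 - x.block ij.2‖

lemma spread_nonneg (x : StackedState p n) : 0 ≤ spread x := norm_nonneg _

lemma norm_block_sub_block_le_spread (x : StackedState p n) (i j : Fin p) :
    ‖x.block i - x.block j‖ ≤ spread x :=
  norm_le_pi_norm (fun ij : Fin p × Fin p => x.block ij.1 - x.block ij.2) (i, j)

lemma spread_le {x : StackedState p n} {C : ℝ} (hC : 0 ≤ C)
    (h : ∀ i j, ‖x.block i - x.block j‖ ≤ C) : spread x ≤ C :=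
  (pi_norm_le_iff_of_nonneg hC).2 fun ij => h ij.1 ij.2

lemma continuous_spread : Continuous (spread : StackedState p n → ℝ) :=
  (continuous_pi fun ij : Fin p × Fin p => (StackedState.continuous_block ij.1).sub
    (StackedState.continuous_block ij.2)).norm

lemma spread_add_const (x : StackedState p n) (c : EuclideanSpace ℝ (Fin n)) :
    spread (x + StackedState.const p c) = spread x := by
  simp [spread]

lemma spread_le_infDist (x : StackedState p n) :
    spread x ≤ 2 * Metric.infDist x (syncManifold p n) := by
  suffices h : spread x / 2 ≤ Metric.infDist x (syncManifold p n) by linarith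
  have h0 : (0 : StackedState p n) ∈ syncManifold p n := fun i j => rfl
  refine (Metric.le_infDist ⟨0, h0⟩).2 fun y hy => ?_
  suffices h : spread x ≤ 2 * dist x y by linarith
  refine spread_le (by positivity) fun i j => ?_
  have h : x.block i - x.block j = (x - y).block i - (x - y).block j := by
    rw [StackedState.block_sub, StackedState.block_sub, hy i j]
    abel
  rw [h, dist_eq_norm]
  have h1 := (x - y).norm_block_le i
  have h2 := (x - y).norm_block_le j
  linarith [norm_sub_le ((x - y).block i) ((x - y).block j)]

lemma infDist_le_spread (x : StackedState p n) (r : Fin p) :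
    Metric.infDist x (syncManifold p n) ≤ p * spread x := by
  have hmem : StackedState.const p (x.block r) ∈ syncManifold p n := fun i j => rfl
  refine (Metric.infDist_le_dist_of_mem hmem).trans ?_
  rw [dist_eq_norm]
  exact StackedState.norm_le_of_norm_block_le fun i => norm_block_sub_block_le_spread x i r

end Spread

/-! ### The averaged system as a consensus dynamics -/

section System

variable {p : ℕ} {γ : Fin p → Fin p → ℝ → ℝ}

/-- The part of the assumptions on the coupling functions that makes the averaged couplings
attractive, though possibly weakly so. -/
structure IsAttractive (γ : Fin p → Fin p → ℝ → ℝ) : Prop where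
  continuous : ∀ i j, i ≠ j → Continuous (γ i j)
  map_zero : ∀ i j, i ≠ j → γ i j 0 = 0
  mul_nonneg : ∀ i j, i ≠ j → ∀ s, 0 ≤ s * γ i j s

/-- The state-dependent gain with which the block `i` is attracted by the block `j`. -/
noncomputable def couplingGain (γ : Fin p → Fin p → ℝ → ℝ) (x : StackedState p 2)
    (i j : Fin p) : ℝ :=
  if i = j then 0 else radialGain (γ i j) ‖x.block j - x.block i‖

lemma IsAttractive.couplingGain_nonneg (hγ : IsAttractive γ) (x : StackedState p 2)
    (i j : Fin p) : 0 ≤ couplingGain γ x i j := by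
  unfold couplingGain
  split_ifs with h
  · exact le_rfl
  · exact radialGain_nonneg (hγ.mul_nonneg i j h) _

lemma block_averagedField (γ : Fin p → Fin p → ℝ → ℝ) (x : StackedState p 2) (i : Fin p) :
    (averagedField γ x).block i =
      ∑ j ∈ Finset.univ.erase i, averagedCoupling (γ i j) (x.block j - x.block i) := rfl

lemma IsAttractive.block_averagedField_eq (hγ : IsAttractive γ) (x : StackedState p 2)
    (i : Fin p) : (averagedField γ x).block i =
      ∑ j, couplingGain γ x i j • (x.block j - x.block i) := by
  rw [block_averagedField, ← Finset.sum_erase (a := i) Finset.univ (by simp)]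
  refine Finset.sum_congr rfl fun j hj => ?_
  have hij : i ≠ j := (Finset.ne_of_mem_erase hj).symm
  rw [averagedCoupling_eq_radialGain_smul (hγ.continuous i j hij) (hγ.map_zero i j hij),
    couplingGain, if_neg hij]

/-- The components of the blocks along a fixed direction follow a scalar consensus dynamics. -/
lemma IsAttractive.hasDerivWithinAt_inner (hγ : IsAttractive γ) {η : ℝ → StackedState p 2}
    (hη : IsAveragedSolution γ η) (v : EuclideanSpace ℝ (Fin 2)) (i : Fin p) (t : ℝ)
    (ht : 0 ≤ t) :
    HasDerivWithinAt (fun t => (inner ℝ v ((η t).block i) : ℝ))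
      (∑ j, couplingGain γ (η t) i j *
        (inner ℝ v ((η t).block j) - inner ℝ v ((η t).block i))) (Set.Ici 0) t := by
  have h : HasDerivWithinAt (fun t => (inner ℝ v ((η t).block i) : ℝ))
      (inner ℝ v ((averagedField γ (η t)).block i)) (Set.Ici 0) t :=
    (innerSL ℝ v ∘L (StackedState.blockₗ p 2 i).toContinuousLinearMap).hasFDerivAt
      |>.comp_hasDerivWithinAt t (hη t ht)
  rw [hγ.block_averagedField_eq, inner_sum] at h
  simpa only [inner_smul_right, inner_sub_right] using h

/-- Every disc that contains all the blocks is forward invariant, since so is every half-plane. -/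
lemma IsAttractive.norm_block_sub_le (hγ : IsAttractive γ) {η : ℝ → StackedState p 2}
    (hη : IsAveragedSolution γ η) {c : EuclideanSpace ℝ (Fin 2)} {R : ℝ}
    (h0 : ∀ i, ‖(η 0).block i - c‖ ≤ R) (i : Fin p) {t : ℝ} (ht : 0 ≤ t) :
    ‖(η t).block i - c‖ ≤ R := by
  set v := (η t).block i - c with hv
  have h := consensus_le (M := inner ℝ v c + ‖v‖ * R) (hγ.hasDerivWithinAt_inner hη v)
    (fun i j t => hγ.couplingGain_nonneg (η t) i j) (fun j => ?_) i ht
  · have h1 : ‖v‖ * ‖v‖ ≤ ‖v‖ * R := by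
      rw [← real_inner_self_eq_norm_mul_norm]
      nth_rw 2 [hv]
      rw [inner_sub_right]
      linarith
    by_contra hlt
    have hRv : R < ‖v‖ := not_le.1 hlt
    have hv0 : 0 < ‖v‖ := (norm_nonneg _).trans_lt ((h0 i).trans_lt hRv)
    exact hlt (le_of_mul_le_mul_left h1 hv0)
  · have h1 := (real_inner_le_norm v ((η 0).block j - c)).trans
      (mul_le_mul_of_nonneg_left (h0 j) (norm_nonneg v))
    rw [inner_sub_right] at h1
    linarith

lemma IsAttractive.spread_le_spread_zero (hγ : IsAttractive γ) {η : ℝ → StackedState p 2}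
    (hη : IsAveragedSolution γ η) {t : ℝ} (ht : 0 ≤ t) : spread (η t) ≤ spread (η 0) := by
  refine spread_le (spread_nonneg _) fun i j => ?_
  -- Apply the invariance to the discs around the initial blocks, then to the one around `η_j(t)`.
  refine hγ.norm_block_sub_le hη (fun k => ?_) i ht
  rw [norm_sub_rev]
  exact hγ.norm_block_sub_le hη (fun l => norm_block_sub_block_le_spread (η 0) l k) j ht

lemma IsAveragedSolution.shift {η : ℝ → StackedState p 2} (hη : IsAveragedSolution γ η) {s : ℝ}
    (hs : 0 ≤ s) : IsAveragedSolution γ fun t => η (s + t) := by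
  intro t ht
  have h1 : HasDerivWithinAt (fun t => s + t) 1 (Set.Ici 0) t :=
    ((hasDerivAt_id t).const_add s).hasDerivWithinAt
  have h2 := (hη (s + t) (add_nonneg hs ht)).scomp t h1
    fun u hu => Set.mem_Ici.2 (add_nonneg hs hu)
  rw [one_smul] at h2
  exact h2

lemma averagedField_add_const (γ : Fin p → Fin p → ℝ → ℝ) (x : StackedState p 2)
    (c : EuclideanSpace ℝ (Fin 2)) :
    averagedField γ (x + StackedState.const p c) = averagedField γ x := by
  simp [averagedField]

lemma IsAveragedSolution.add_const {η : ℝ → StackedState p 2} (hη : IsAveragedSolution γ η)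
    (c : EuclideanSpace ℝ (Fin 2)) :
    IsAveragedSolution γ fun t => η t + StackedState.const p c := by
  intro t ht
  rw [averagedField_add_const]
  exact (hη t ht).add_const _

lemma IsAttractive.spread_antitone (hγ : IsAttractive γ) {η : ℝ → StackedState p 2}
    (hη : IsAveragedSolution γ η) {s t : ℝ} (hs : 0 ≤ s) (hst : s ≤ t) :
    spread (η t) ≤ spread (η s) := by
  simpa using hγ.spread_le_spread_zero (hη.shift hs) (sub_nonneg.2 hst)

/-! ### Strict decrease of the spread -/

/-- Interconnections with globally Lipschitz and bounded couplings. The global bounds make the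
averaged field globally Lipschitz and bounded; truncation reduces the general case to this one. -/
structure IsTame (γ : Fin p → Fin p → ℝ → ℝ) (K B : ℝ≥0) : Prop where
  lipschitz : ∀ i j, i ≠ j → LipschitzWith K (γ i j)
  abs_le : ∀ i j, i ≠ j → ∀ s, |γ i j s| ≤ B
  map_zero : ∀ i j, i ≠ j → γ i j 0 = 0
  mul_nonneg : ∀ i j, i ≠ j → ∀ s, 0 ≤ s * γ i j s
  ne_zero : ∀ i j, (interconnectionGraph γ).Adj i j → ∀ s, s ≠ 0 → γ i j s ≠ 0

variable {K B : ℝ≥0}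

lemma IsTame.isAttractive (hγ : IsTame γ K B) : IsAttractive γ :=
  ⟨fun i j h => (hγ.lipschitz i j h).continuous, hγ.map_zero, hγ.mul_nonneg⟩

lemma IsTame.couplingGain_le (hγ : IsTame γ K B) (x : StackedState p 2) (i j : Fin p) :
    couplingGain γ x i j ≤ K := by
  unfold couplingGain
  split_ifs with h
  · exact K.2
  · exact radialGain_le (hγ.lipschitz i j h) (hγ.map_zero i j h) (hγ.mul_nonneg i j h) _

lemma IsTame.block_eq_of_couplingGain_eq_zero (hγ : IsTame γ K B) {x : StackedState p 2}
    {i j : Fin p} (hij : (interconnectionGraph γ).Adj i j) (h : couplingGain γ x i j = 0) :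
    x.block j = x.block i := by
  have hne : i ≠ j := hij.1
  by_contra hx
  rw [couplingGain, if_neg hne] at h
  exact (radialGain_pos (hγ.lipschitz i j hne).continuous (hγ.mul_nonneg i j hne)
    (hγ.ne_zero i j hij) (norm_ne_zero_iff.2 (sub_ne_zero.2 hx))).ne' h

/-- If the spread were conserved, then two blocks would realize it at time `t`, and in the direction
joining them both extreme values would be conserved. All nodes that influence an extreme block start
at that extreme value; the root node influences both, so the two extremes coincide. -/
lemma IsTame.spread_lt (hγ : IsTame γ K B) (hconn : (interconnectionGraph γ).IsRootConnected)
    {η : ℝ → StackedState p 2} (hη : IsAveragedSolution γ η) (h0 : 0 < spread (η 0)) {t : ℝ}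
    (ht : 0 < t) : spread (η t) < spread (η 0) := by
  obtain ⟨r, hr⟩ := hconn
  have hpath : ∀ i, Relation.ReflTransGen (interconnectionGraph γ).Adj i r := fun i => by
    obtain rfl | hi := eq_or_ne i r
    · exact Relation.ReflTransGen.refl
    · exact hr i hi
  have hatt := hγ.isAttractive
  refine (pi_norm_lt_iff h0).2 fun ⟨i, j⟩ => ?_
  refine lt_of_le_of_ne ((norm_block_sub_block_le_spread (η t) i j).trans
    (hatt.spread_le_spread_zero hη ht.le)) fun heq => ?_
  have hnon : Nonempty (Fin p) := ⟨r⟩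
  set v := (η t).block i - (η t).block j with hv
  have hv0 : 0 < ‖v‖ := by rw [heq]; exact h0
  -- In every direction `w`, the values of all blocks stay below their initial maximum.
  have hdir : ∀ w : EuclideanSpace ℝ (Fin 2), ∃ k, (∀ l, (inner ℝ w ((η 0).block l) : ℝ) ≤
      inner ℝ w ((η 0).block k)) ∧
      (∀ l, (inner ℝ w ((η t).block l) : ℝ) ≤ inner ℝ w ((η 0).block k)) ∧
      ∀ l, (inner ℝ w ((η t).block l) : ℝ) = inner ℝ w ((η 0).block k) →
        (inner ℝ w ((η 0).block r) : ℝ) = inner ℝ w ((η 0).block k) := fun w => by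
    obtain ⟨k, hk⟩ := Finite.exists_max fun l => (inner ℝ w ((η 0).block l) : ℝ)
    have hd := hatt.hasDerivWithinAt_inner hη w
    have hnn := fun i j t => hatt.couplingGain_nonneg (η t) i j
    refine ⟨k, hk, fun l => consensus_le hd hnn hk l ht.le, fun l hl => ?_⟩
    exact consensus_initial_eq_of_eq hd hnn (fun i j t => hγ.couplingGain_le (η t) i j)
      (fun i j t hij h => by rw [hγ.block_eq_of_couplingGain_eq_zero hij h]) hk ht hl (hpath l)
  obtain ⟨k, -, hk', hk⟩ := hdir v
  obtain ⟨l, -, hl', hl⟩ := hdir (-v)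
  have h1 := hk' i
  have h2 := hl' j
  have h3 := hk i
  have h4 := hl j
  simp only [inner_neg_left] at h2 h4
  have h5 : (inner ℝ v ((η t).block i) : ℝ) - inner ℝ v ((η t).block j) = ‖v‖ * ‖v‖ := by
    rw [← inner_sub_right, ← hv, real_inner_self_eq_norm_mul_norm]
  have h6 : (inner ℝ v ((η 0).block k) : ℝ) - inner ℝ v ((η 0).block l) ≤ ‖v‖ * ‖v‖ := by
    rw [← inner_sub_right]
    refine (real_inner_le_norm _ _).trans (mul_le_mul_of_nonneg_left ?_ hv0.le)
    rw [heq]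
    exact norm_block_sub_block_le_spread (η 0) k l
  have h7 := h3 (by linarith)
  have h8 := h4 (by linarith)
  have : 0 < ‖v‖ * ‖v‖ := mul_pos hv0 hv0
  linarith

/-! ### The flow of a tame interconnection and uniform attraction -/

lemma IsTame.lipschitzWith_averagedField (hγ : IsTame γ K B) :
    LipschitzWith (p * (p * (K * 2))) (averagedField γ) := by
  refine LipschitzWith.of_dist_le_mul fun x y => ?_
  rw [dist_eq_norm, dist_eq_norm, NNReal.coe_mul, mul_assoc]
  refine StackedState.norm_le_of_norm_block_le fun i => ?_
  rw [StackedState.block_sub, block_averagedField, block_averagedField,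
    ← Finset.sum_sub_distrib]
  have hterm : ∀ j ∈ Finset.univ.erase i, ‖averagedCoupling (γ i j) (x.block j - x.block i) -
      averagedCoupling (γ i j) (y.block j - y.block i)‖ ≤ K * (2 * ‖x - y‖) := fun j hj => by
    have h := (lipschitzWith_averagedCoupling
      (hγ.lipschitz i j (Finset.ne_of_mem_erase hj).symm)).dist_le_mul
      (x.block j - x.block i) (y.block j - y.block i)
    rw [dist_eq_norm, dist_eq_norm] at h
    refine h.trans (mul_le_mul_of_nonneg_left ?_ K.2)
    have h1 := (x - y).norm_block_le i
    have h2 := (x - y).norm_block_le j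
    have h3 : x.block j - x.block i - (y.block j - y.block i) =
        (x - y).block j - (x - y).block i := by
      rw [StackedState.block_sub, StackedState.block_sub]
      abel
    rw [h3]
    linarith [norm_sub_le ((x - y).block j) ((x - y).block i)]
  refine (norm_sum_le_of_le _ hterm).trans ?_
  rw [Finset.sum_const, nsmul_eq_mul]
  have hcard : ((Finset.univ.erase i).card : ℝ) ≤ p := by
    exact_mod_cast (Finset.card_le_univ _).trans_eq (Fintype.card_fin p)
  calc _ ≤ (p : ℝ) * (K * (2 * ‖x - y‖)) := mul_le_mul_of_nonneg_right hcard (by positivity)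
    _ = _ := by push_cast; ring

lemma IsTame.norm_averagedField_le (hγ : IsTame γ K B) (x : StackedState p 2) :
    ‖averagedField γ x‖ ≤ (p * (p * B) : ℝ≥0) := by
  push_cast
  refine StackedState.norm_le_of_norm_block_le fun i => ?_
  rw [block_averagedField]
  refine (norm_sum_le_of_le _ fun j hj => norm_averagedCoupling_le
    (hγ.abs_le i j (Finset.ne_of_mem_erase hj).symm) _).trans ?_
  rw [Finset.sum_const, nsmul_eq_mul]
  have hcard : ((Finset.univ.erase i).card : ℝ) ≤ p := by
    exact_mod_cast (Finset.card_le_univ _).trans_eq (Fintype.card_fin p)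
  exact mul_le_mul_of_nonneg_right hcard B.2

lemma IsTame.exists_isAveragedSolution (hγ : IsTame γ K B) (x : StackedState p 2) :
    ∃ η, IsAveragedSolution γ η ∧ η 0 = x :=
  exists_hasDerivWithinAt_Ici hγ.lipschitzWith_averagedField hγ.norm_averagedField_le x

/-- On the compact set of states with blocks in the disc of radius `s` and spread at least `ε`, one
unit of time lowers the spread by at least some `δ > 0`. -/
lemma IsTame.exists_spread_add_le (hγ : IsTame γ K B)
    (hconn : (interconnectionGraph γ).IsRootConnected) (s : ℝ) {ε : ℝ} (hε : 0 < ε) :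
    ∃ δ > 0, ∀ η : ℝ → StackedState p 2, IsAveragedSolution γ η →
      (∀ i, ‖(η 0).block i‖ ≤ s) → ε ≤ spread (η 0) → spread (η 1) + δ ≤ spread (η 0) := by
  choose Φ hΦ hΦ0 using hγ.exists_isAveragedSolution
  have hcont : Continuous fun x => Φ x 1 := by
    set L : ℝ≥0 := p * (p * (K * 2))
    refine (LipschitzWith.of_dist_le_mul (K := ⟨Real.exp (L * 1), (Real.exp_pos _).le⟩)
      fun x y => ?_).continuous
    have h := dist_le_of_hasDerivWithinAt_Ici hγ.lipschitzWith_averagedField (hΦ x) (hΦ y)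
      zero_le_one
    rw [hΦ0, hΦ0, mul_comm] at h
    exact h
  set C : Set (StackedState p 2) := {x | (∀ i, ‖x.block i‖ ≤ s) ∧ ε ≤ spread x}
  have hC : IsCompact C := by
    refine Metric.isCompact_of_isClosed_isBounded ?_ ?_
    · refine IsClosed.inter (s₁ := {x : StackedState p 2 | ∀ i, ‖x.block i‖ ≤ s}) ?_
        (isClosed_le continuous_const continuous_spread)
      rw [show {x : StackedState p 2 | ∀ i, ‖x.block i‖ ≤ s} = ⋂ i, {x | ‖x.block i‖ ≤ s} by
        ext x; simp]
      exact isClosed_iInter fun i =>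
        isClosed_le (StackedState.continuous_block i).norm continuous_const
    · exact (Metric.isBounded_closedBall (x := 0) (r := p * s)).subset fun x hx => by
        simpa using StackedState.norm_le_of_norm_block_le hx.1
  have hdrop : ∃ δ > 0, ∀ x ∈ C, δ ≤ spread x - spread (Φ x 1) := by
    obtain hne | hne := C.eq_empty_or_nonempty
    · exact ⟨1, one_pos, by simp [hne]⟩
    obtain ⟨x, hx, hmin⟩ := hC.exists_isMinOn hne
      (continuous_spread.sub (continuous_spread.comp hcont)).continuousOn
    refine ⟨spread x - spread (Φ x 1), ?_, fun y hy => hmin hy⟩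
    have h := hγ.spread_lt hconn (hΦ x) (by rw [hΦ0]; exact hε.trans_le hx.2) one_pos
    rw [hΦ0] at h
    exact sub_pos.2 h
  obtain ⟨δ, hδ, hdrop⟩ := hdrop
  refine ⟨δ, hδ, fun η hη hs hε' => ?_⟩
  have heq : η 1 = Φ (η 0) 1 := by
    have h := dist_le_of_hasDerivWithinAt_Ici hγ.lipschitzWith_averagedField hη (hΦ (η 0))
      zero_le_one
    rw [hΦ0, dist_self, zero_mul] at h
    exact dist_le_zero.1 h
  have := hdrop (η 0) ⟨hs, hε'⟩
  rw [heq]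
  linarith

lemma IsTame.exists_forall_spread_le (hγ : IsTame γ K B)
    (hconn : (interconnectionGraph γ).IsRootConnected) (s : ℝ) {ε : ℝ} (hε : 0 < ε) :
    ∃ T : ℝ, 0 ≤ T ∧ ∀ η : ℝ → StackedState p 2, IsAveragedSolution γ η → spread (η 0) ≤ s →
      ∀ t, T ≤ t → spread (η t) ≤ ε := by
  obtain ⟨δ, hδ, hdrop⟩ := hγ.exists_spread_add_le hconn s hε
  obtain ⟨r, -⟩ := hconn
  obtain ⟨n, hn⟩ := exists_nat_ge (s / δ)
  have hatt := hγ.isAttractive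
  refine ⟨n, n.cast_nonneg, fun η hη hs t ht => ?_⟩
  -- By translation invariance, the block `r` may be assumed to start at the origin.
  wlog hr : (η 0).block r = 0 generalizing η
  · have h := this (fun t => η t + StackedState.const p (-(η 0).block r)) (hη.add_const _)
      (by rwa [spread_add_const]) (by simp)
    rwa [spread_add_const] at h
  have hball : ∀ t, 0 ≤ t → ∀ i, ‖(η t).block i‖ ≤ s := fun t ht i => by
    have h := hatt.norm_block_sub_le (c := 0) (R := s) hη (fun i => ?_) i ht
    · simpa using h
    · rw [← hr]
      exact (norm_block_sub_block_le_spread (η 0) i r).trans hs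
  have hstep : ∀ m : ℕ, spread (η m) ≤ max ε (s - m * δ) := fun m => by
    induction m with
    | zero => simpa using Or.inr hs
    | succ m ih =>
      have hm : (0 : ℝ) ≤ m := m.cast_nonneg
      obtain hlt | hge := lt_or_ge (spread (η m)) ε
      · refine le_max_of_le_left ((hatt.spread_antitone hη hm ?_).trans hlt.le)
        push_cast
        linarith
      · have h := hdrop _ (hη.shift hm) (by simpa using hball m hm) (by simpa using hge)
        rw [add_zero] at h
        push_cast
        obtain h' | h' := le_max_iff.1 ih
        · exact le_max_of_le_left (by linarith)
        · exact le_max_of_le_right (by linarith)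
  refine (hatt.spread_antitone hη n.cast_nonneg ht).trans ((hstep n).trans (max_le le_rfl ?_))
  rw [div_le_iff₀ hδ] at hn
  linarith

end System

/-! ### Truncation of the couplings -/

section Truncation

variable {p : ℕ} {γ : Fin p → Fin p → ℝ → ℝ}

lemma IsInterconnection.isAttractive (hγ : IsInterconnection γ)
    (hlip : ∀ i j, i ≠ j → LocallyLipschitz (γ i j)) : IsAttractive γ :=
  ⟨fun i j h => (hlip i j h).continuous, hγ.map_zero, hγ.mul_nonneg⟩

/-- Freezing a coupling function outside `[-R, R]`. -/
noncomputable def truncate (R : ℝ) (g : ℝ → ℝ) (s : ℝ) : ℝ :=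
  g (max (-R) (min s R))

lemma truncate_of_abs_le {R : ℝ} (g : ℝ → ℝ) {s : ℝ} (hs : |s| ≤ R) : truncate R g s = g s := by
  rw [truncate, min_eq_left (abs_le.1 hs).2, max_eq_right (abs_le.1 hs).1]

lemma abs_max_min_le {R : ℝ} (hR : 0 ≤ R) (s : ℝ) : |max (-R) (min s R)| ≤ R :=
  abs_le.2 ⟨le_max_left _ _, max_le (by linarith) (min_le_right _ _)⟩

lemma exists_lipschitzWith_truncate {g : ℝ → ℝ} (hg : LocallyLipschitz g) {R : ℝ} (hR : 0 ≤ R) :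
    ∃ K : ℝ≥0, LipschitzWith K (truncate R g) := by
  obtain ⟨K, hK⟩ := (hg.locallyLipschitzOn (s := Set.Icc (-R) R)).exists_lipschitzOnWith_of_compact
    isCompact_Icc
  refine ⟨K, LipschitzWith.of_dist_le_mul fun s t => ?_⟩
  refine (hK.dist_le_mul _ (abs_le.1 (abs_max_min_le hR s)) _
    (abs_le.1 (abs_max_min_le hR t))).trans (mul_le_mul_of_nonneg_left ?_ K.2)
  rw [Real.dist_eq, Real.dist_eq]
  have h1 := abs_max_sub_max_le_max (-R) (min s R) (-R) (min t R)
  have h2 := abs_min_sub_min_le_max s R t R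
  simp only [sub_self, abs_zero, abs_nonneg, max_eq_left, max_eq_right] at h1 h2
  exact h1.trans h2

lemma IsInterconnection.ne_zero (hγ : IsInterconnection γ) {i j : Fin p}
    (h : (interconnectionGraph γ).Adj i j) {s : ℝ} (hs : s ≠ 0) : γ i j s ≠ 0 := by
  obtain ⟨hij, u, hu⟩ := h
  obtain h0 | ⟨α, hα, hle⟩ := hγ.zero_or_bound i j hij
  · exact absurd (h0 u) hu
  · have hpos : 0 < α ‖s‖₊ := by
      rw [← hα.map_zero]
      exact hα.strictMono (by simpa using hs)
    exact abs_pos.1 ((NNReal.coe_pos.2 hpos).trans_le (hle s))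

/-- Truncated couplings are tame and keep the graph of the interconnection. -/
lemma IsInterconnection.exists_isTame_truncate (hγ : IsInterconnection γ)
    (hlip : ∀ i j, i ≠ j → LocallyLipschitz (γ i j))
    (hconn : (interconnectionGraph γ).IsRootConnected) {R : ℝ} (hR : 0 < R) :
    (∃ K B, IsTame (fun i j => truncate R (γ i j)) K B) ∧
      (interconnectionGraph fun i j => truncate R (γ i j)).IsRootConnected := by
  have hK : ∀ i j, ∃ K : ℝ≥0, i ≠ j → LipschitzWith K (truncate R (γ i j)) := fun i j => by
    by_cases h : i = j
    · exact ⟨0, fun h' => absurd h h'⟩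
    · obtain ⟨K, hK⟩ := exists_lipschitzWith_truncate (hlip i j h) hR.le
      exact ⟨K, fun _ => hK⟩
  choose K hK using hK
  set L : ℝ≥0 := Finset.univ.sup fun ij : Fin p × Fin p => K ij.1 ij.2
  have hL : ∀ i j, i ≠ j → LipschitzWith L (truncate R (γ i j)) := fun i j h =>
    (hK i j h).weaken
      (Finset.le_sup (f := fun ij : Fin p × Fin p => K ij.1 ij.2) (Finset.mem_univ (i, j)))
  have hmul : ∀ i j, i ≠ j → ∀ s, 0 ≤ s * truncate R (γ i j) s := fun i j h s => by
    have h1 := hγ.mul_nonneg i j h (max (-R) (min s R))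
    unfold truncate
    obtain hs | rfl | hs := lt_trichotomy s 0
    · have h2 : max (-R) (min s R) < 0 := max_lt (by linarith) (min_lt_of_left_lt hs)
      exact _root_.mul_nonneg_of_nonpos_of_nonpos hs.le (nonpos_of_mul_nonneg_right h1 h2)
    · simp
    · have h2 : 0 < max (-R) (min s R) := lt_max_of_lt_right (lt_min hs hR)
      exact _root_.mul_nonneg hs.le (nonneg_of_mul_nonneg_right h1 h2)
  have hzero : ∀ g : ℝ → ℝ, truncate R g 0 = g 0 := fun g =>
    truncate_of_abs_le g (by simpa using hR.le)
  have hadj : ∀ i j, (interconnectionGraph fun i j => truncate R (γ i j)).Adj i j ↔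
      (interconnectionGraph γ).Adj i j := fun i j => by
    refine ⟨fun ⟨h, s, hs⟩ => ⟨h, _, hs⟩, fun h => ⟨h.1, R, ?_⟩⟩
    exact (truncate_of_abs_le (γ i j) (abs_of_pos hR).le).trans_ne (hγ.ne_zero h hR.ne')
  refine ⟨⟨L, L * ⟨R, hR.le⟩, hL, fun i j h s => ?_, fun i j h => ?_, hmul, fun i j h s hs => ?_⟩,
    ?_⟩
  · have hR' := abs_max_min_le hR.le s
    have h1 := (hL i j h).dist_le_mul (max (-R) (min s R)) 0
    rw [truncate_of_abs_le _ hR', hzero, hγ.map_zero i j h, dist_zero_right, dist_zero_right] at h1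
    exact h1.trans (mul_le_mul_of_nonneg_left hR' L.2)
  · rw [hzero, hγ.map_zero i j h]
  · refine hγ.ne_zero ((hadj i j).1 h) ?_
    obtain hs | hs := lt_or_gt_of_ne hs
    · exact (max_lt (by linarith) (min_lt_of_left_lt hs)).ne
    · exact (lt_max_of_lt_right (lt_min hs hR)).ne'
  · obtain ⟨r, hr⟩ := hconn
    exact ⟨r, fun v hv => Relation.ReflTransGen.mono (fun i j h => (hadj i j).2 h) _ _ (hr v hv)⟩

lemma averagedField_truncate {R : ℝ} {x : StackedState p 2} (hx : spread x ≤ R) :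
    averagedField (fun i j => truncate R (γ i j)) x = averagedField γ x := by
  have h : ∀ i j, averagedCoupling (truncate R (γ i j)) (x.block j - x.block i) =
      averagedCoupling (γ i j) (x.block j - x.block i) := fun i j =>
    averagedCoupling_congr fun s hs => truncate_of_abs_le _
      (hs.trans ((norm_block_sub_block_le_spread x j i).trans hx))
  simp only [averagedField, h]

/-- As the spread never exceeds its initial value, the truncation is invisible to solutions of
initial spread at most `R`. -/
lemma IsInterconnection.isAveragedSolution_truncate_iff (hγ : IsInterconnection γ)
    (hlip : ∀ i j, i ≠ j → LocallyLipschitz (γ i j))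
    (hconn : (interconnectionGraph γ).IsRootConnected) {R : ℝ} (hR : 0 < R)
    {η : ℝ → StackedState p 2} (h0 : spread (η 0) ≤ R) :
    IsAveragedSolution (fun i j => truncate R (γ i j)) η ↔ IsAveragedSolution γ η := by
  obtain ⟨⟨K, B, hK⟩, -⟩ := hγ.exists_isTame_truncate hlip hconn hR
  constructor <;> intro hη t ht
  · rw [← averagedField_truncate ((hK.isAttractive.spread_le_spread_zero hη ht).trans h0)]
    exact hη t ht
  · rw [averagedField_truncate
      (((hγ.isAttractive hlip).spread_le_spread_zero hη ht).trans h0)]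
    exact hη t ht

lemma IsInterconnection.exists_isAveragedSolution (hγ : IsInterconnection γ)
    (hlip : ∀ i j, i ≠ j → LocallyLipschitz (γ i j))
    (hconn : (interconnectionGraph γ).IsRootConnected) (x : StackedState p 2) :
    ∃ η, IsAveragedSolution γ η ∧ η 0 = x := by
  have hR : 0 < spread x + 1 := by linarith [spread_nonneg x]
  obtain ⟨⟨K, B, hK⟩, -⟩ := hγ.exists_isTame_truncate hlip hconn hR
  obtain ⟨η, hη, h0⟩ := hK.exists_isAveragedSolution x
  exact ⟨η, (hγ.isAveragedSolution_truncate_iff hlip hconn hR (by rw [h0]; linarith)).1 hη, h0⟩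

/-- Uniform attraction: the time needed to bring the spread below `ε` depends only on a bound on the
initial spread. -/
lemma IsInterconnection.exists_forall_spread_le (hγ : IsInterconnection γ)
    (hlip : ∀ i j, i ≠ j → LocallyLipschitz (γ i j))
    (hconn : (interconnectionGraph γ).IsRootConnected) (s : ℝ) {ε : ℝ} (hε : 0 < ε) :
    ∃ T : ℝ, 0 ≤ T ∧ ∀ η : ℝ → StackedState p 2, IsAveragedSolution γ η → spread (η 0) ≤ s →
      ∀ t, T ≤ t → spread (η t) ≤ ε := by
  have hR : 0 < max s 1 := lt_max_of_lt_right one_pos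
  obtain ⟨⟨K, B, hK⟩, hconn'⟩ := hγ.exists_isTame_truncate hlip hconn hR
  obtain ⟨T, hT, h⟩ := hK.exists_forall_spread_le hconn' s hε
  exact ⟨T, hT, fun η hη hs => h η ((hγ.isAveragedSolution_truncate_iff hlip hconn hR
    (hs.trans (le_max_left _ _))).2 hη) hs⟩

end Truncation

/-! ### The comparison function -/

/-- Uniform linear stability and uniform attraction of a family of nonnegative trajectories yield a
class-`KL` bound: take the supremum, over all trajectories starting below `s`, of the values from
time `t` on. -/
lemma exists_isClassKL {S : Set (ℝ≥0 → ℝ≥0)} (C : ℝ≥0) (hC : ∀ f ∈ S, ∀ t, f t ≤ C * f 0)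
    (hatt : ∀ s ε : ℝ≥0, 0 < ε → ∃ T, ∀ f ∈ S, f 0 ≤ s → ∀ t, T ≤ t → f t ≤ ε) :
    ∃ β, IsClassKL β ∧ ∀ f ∈ S, ∀ t, f t ≤ β (f 0) t := by
  set V : ℝ≥0 → ℝ≥0 → Set ℝ≥0 := fun s t => {d | ∃ f ∈ S, f 0 ≤ s ∧ ∃ u, t ≤ u ∧ f u = d}
  have hle : ∀ s t, ∀ d ∈ V s t, d ≤ C * s := by
    rintro s t d ⟨f, hf, hs, u, -, rfl⟩
    exact (hC f hf u).trans (mul_le_mul_of_nonneg_left hs C.2)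
  have hbdd : ∀ s t, BddAbove (V s t) := fun s t => ⟨C * s, hle s t⟩
  have hmono : ∀ {s s' t t'}, s ≤ s' → t' ≤ t → sSup (V s t) ≤ sSup (V s' t') := by
    intro s s' t t' hs ht
    refine csSup_le' fun d hd => le_csSup (hbdd s' t') ?_
    obtain ⟨f, hf, hfs, u, hu, rfl⟩ := hd
    exact ⟨f, hf, hfs.trans hs, u, ht.trans hu, rfl⟩
  refine ⟨fun s t => sSup (V s t), ⟨fun t s s' hs => hmono hs le_rfl, fun t => ?_,
    fun s t t' ht => hmono le_rfl ht, fun s => ?_⟩, fun f hf t =>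
      le_csSup (hbdd _ _) ⟨f, hf, le_rfl, t, le_rfl, rfl⟩⟩
  · have h1 : Filter.Tendsto (fun s : ℝ≥0 => C * s) (𝓝[>] 0) (𝓝 0) := by
      have h2 : Continuous fun s : ℝ≥0 => C * s := by fun_prop
      simpa using (h2.tendsto 0).mono_left nhdsWithin_le_nhds
    exact tendsto_of_tendsto_of_tendsto_of_le_of_le tendsto_const_nhds h1 (fun s => zero_le)
      fun s => csSup_le' (hle s t)
  · refine NNReal.tendsto_coe.1 (Metric.tendsto_atTop.2 fun ε hε => ?_)
    obtain ⟨T, hT⟩ := hatt s ⟨ε / 2, by positivity⟩ (half_pos hε)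
    refine ⟨T, fun t ht => ?_⟩
    have h : sSup (V s t) ≤ ⟨ε / 2, by positivity⟩ := by
      refine csSup_le' ?_
      rintro d ⟨f, hf, hs, u, hu, rfl⟩
      exact hT f hf hs u (ht.trans hu)
    have h' : ((sSup (V s t) : ℝ≥0) : ℝ) ≤ ε / 2 := h
    rw [NNReal.coe_zero, dist_zero_right, NNReal.norm_eq]
    linarith

theorem theorem1 {p : ℕ} (γ : Fin p → Fin p → ℝ → ℝ)
    (hγ : IsInterconnection γ)
    (hlip : ∀ i j, i ≠ j → LocallyLipschitz (γ i j))
    (hconn : (interconnectionGraph γ).IsRootConnected) :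
    (∀ η₀ : StackedState p 2, ∃ η : ℝ → StackedState p 2, IsAveragedSolution γ η ∧ η 0 = η₀) ∧
    ∃ β : ℝ≥0 → ℝ≥0 → ℝ≥0, IsClassKL β ∧
      ∀ η : ℝ → StackedState p 2, IsAveragedSolution γ η →
        ∀ t : ℝ≥0, Metric.infNndist (η t) (syncManifold p 2) ≤
          β (Metric.infNndist (η 0) (syncManifold p 2)) t := by
  refine ⟨hγ.exists_isAveragedSolution hlip hconn, ?_⟩
  obtain ⟨r, -⟩ := id hconn
  have hp : (0 : ℝ) < p := by exact_mod_cast r.pos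
  suffices h : ∃ β, IsClassKL β ∧ ∀ f ∈ {f | ∃ η, IsAveragedSolution γ η ∧
      f = fun t : ℝ≥0 => Metric.infNndist (η t) (syncManifold p 2)}, ∀ t, f t ≤ β (f 0) t by
    obtain ⟨β, hβ, h⟩ := h
    exact ⟨β, hβ, fun η hη t => h _ ⟨η, hη, rfl⟩ t⟩
  refine exists_isClassKL (p * 2) ?_ ?_
  · rintro f ⟨η, hη, rfl⟩ t
    rw [← NNReal.coe_le_coe]
    push_cast
    rw [Metric.coe_infNndist, Metric.coe_infNndist, mul_assoc]
    exact (infDist_le_spread (η t) r).trans (mul_le_mul_of_nonneg_left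
      (((hγ.isAttractive hlip).spread_le_spread_zero hη t.2).trans (spread_le_infDist _)) hp.le)
  · intro s ε hε
    obtain ⟨T, hT, h⟩ := hγ.exists_forall_spread_le hlip hconn (2 * s)
      (div_pos (NNReal.coe_pos.2 hε) hp)
    refine ⟨⟨T, hT⟩, ?_⟩
    rintro f ⟨η, hη, rfl⟩ hs t ht
    rw [← NNReal.coe_le_coe, Metric.coe_infNndist] at hs ⊢
    have h1 := h η hη ((spread_le_infDist _).trans
      (mul_le_mul_of_nonneg_left hs two_pos.le)) t (NNReal.coe_le_coe.2 ht)
    refine (infDist_le_spread (η t) r).trans ?_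
    rw [le_div_iff₀ hp] at h1
    linarith
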